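/- Let $\mathcal A$ be a unital $C^*$-algebra and let $H_{\mathcal A}$ be the standard Hilbert $\mathcal A$-module, i.e. the module of all sequences $x=(x_k)_{k\in\mathbb N}$ in $\mathcal A$ for which $\sum_k x_kx_k^*$ converges in norm, with $\mathcal A$ acting coordinatewise by left multiplication, $\langle x,y\rangle=\sum_k y_kx_k^*$ and $\|x\|=\|\langle x,x\rangle\|^{1/2}$. (The version for right modules is the same statement for the opposite algebra.) Let $B^a(H_{\mathcal A})$ be the set of bounded adjointable operators on $H_{\mathcal A}$, and let $K(H_{\mathcal A})$ be the compact operators, i.e. the operator-norm closure of the linear span of the operators $z\mapsto\langle y,z\rangle x$, $x,y\in H_{\mathcal A}$. Let ${\mathcal M\Phi_+^-}'(H_{\mathcal A})$ be the set of all $F\in B^a(H_{\mathcal A})$ for which there are closed submodules $M_1,N_1,M_2,N_2$ of $H_{\mathcal A}$ such that - $H_{\mathcal A}=M_1\,\tilde\oplus\, N_1=M_2\,\tilde\oplus\, N_2$ (direct sums, not necessarily orthogonal); - $F(M_1)\subseteq M_2$, $F(N_1)\subseteq N_2$, and $F|_{M_1}:M_1\to M_2$ is an isomorphism; - $N_1$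 is finitely generated; - $N_1$ is isomorphic to a closed submodule of $N_2$. Here an isomorphism is a bounded $\mathcal A$-linear bijection with bounded inverse, and a submodule is finitely generated if it is the $\mathcal A$-linear span of finitely many of its elements. **Theorem.** For $F\in B^a(H_{\mathcal A})$ the following are equivalent: 1. $F\in{\mathcal M\Phi_+^-}'(H_{\mathcal A})$; 2. there exist $D\in B^a(H_{\mathcal A})$ and $K\in K(H_{\mathcal A})$ such that $D$ is bounded below (there is $c>0$ with $\|Dx\|\ge c\|x\|$ for all $x$) and $F=D+K$. -/

import Mathlib

open scoped ComplexOrder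

section StandardModule

variable {A : Type*} [CStarAlgebra A]

theorem summable_mul_star_smul (a : A) {x : ℕ → A}
    (hx : Summable fun k => x k * star (x k)) :
    Summable fun k => (a * x k) * star (a * x k) := by
  have h := (hx.mul_left a).mul_right (star a)
  refine h.congr fun k => ?_
  simp [mul_assoc]

variable [PartialOrder A] [StarOrderedRing A]

/-- Comparison test for series of positive elements of a `C⋆`-algebra. -/
theorem summable_of_nonneg_of_le_cstar {ι : Type*} {f g : ι → A} (hf : ∀ i, 0 ≤ f i)
    (hfg : ∀ i, f i ≤ g i) (hg : Summable g) : Summable f := by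
  rw [summable_iff_vanishing_norm] at hg ⊢
  intro ε hε
  obtain ⟨s, hs⟩ := hg ε hε
  refine ⟨s, fun t ht => lt_of_le_of_lt ?_ (hs t ht)⟩
  exact CStarAlgebra.norm_le_norm_of_nonneg_of_le (Finset.sum_nonneg fun i _ => hf i)
    (Finset.sum_le_sum fun i _ => hfg i)

theorem summable_add_mul_star {x y : ℕ → A} (hx : Summable fun k => x k * star (x k))
    (hy : Summable fun k => y k * star (y k)) :
    Summable fun k => (x k + y k) * star (x k + y k) := by
  refine summable_of_nonneg_of_le_cstar (fun k => mul_star_self_nonneg _) (fun k => ?_)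
    ((hx.add hy).add (hx.add hy))
  have h : 0 ≤ (x k - y k) * star (x k - y k) := mul_star_self_nonneg _
  rw [← sub_nonneg]
  convert h using 1
  simp only [star_add, star_sub]
  noncomm_ring

variable (A) in
/-- The sequences `x` in `A` for which `∑ x k * star (x k)` converges in norm. (The terms are
positive, so unconditional convergence is the same as convergence of the partial sums.) -/
def stdSubmodule : Submodule A (ℕ → A) where
  carrier := {x | Summable fun k => x k * star (x k)}
  add_mem' hx hy := summable_add_mul_star hx hy
  zero_mem' := by simp
  smul_mem' a _ hx := summable_mul_star_smul a hx

variable (A) in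
/-- The standard Hilbert module `H_A` over `A`. As in Mathlib's `CStarModule`, the algebra acts on
the left and the inner product is `A`-linear in its second variable. The type is not reducible to a
subtype of `ℕ → A`, so that it does not inherit the product topology. -/
def StdModule : Type _ := stdSubmodule A

namespace StdModule

noncomputable instance : AddCommGroup (StdModule A) := inferInstanceAs (AddCommGroup (stdSubmodule A))

noncomputable instance : Module A (StdModule A) := inferInstanceAs (Module A (stdSubmodule A))

noncomputable instance : Module ℂ (StdModule A) := inferInstanceAs (Module ℂ (stdSubmodule A))

instance : IsScalarTower ℂ A (StdModule A) :=
  inferInstanceAs (IsScalarTower ℂ A (stdSubmodule A))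

/-- The `k`-th coordinate of an element of `H_A`. -/
def coord (x : StdModule A) (k : ℕ) : A := x.1 k

@[ext]
theorem ext {x y : StdModule A} (h : ∀ k, x.coord k = y.coord k) : x = y :=
  Subtype.ext (funext h)

@[simp] theorem coord_add (x y : StdModule A) (k : ℕ) :
    (x + y).coord k = x.coord k + y.coord k := rfl

@[simp] theorem coord_zero (k : ℕ) : (0 : StdModule A).coord k = 0 := rfl

@[simp] theorem coord_smul (a : A) (x : StdModule A) (k : ℕ) :
    (a • x).coord k = a * x.coord k := rfl

@[simp] theorem coord_smul_complex (z : ℂ) (x : StdModule A) (k : ℕ) :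
    (z • x).coord k = z • x.coord k := rfl

theorem summable_self (x : StdModule A) : Summable fun k => x.coord k * star (x.coord k) := x.2

theorem summable_inner (x y : StdModule A) : Summable fun k => y.coord k * star (x.coord k) := by
  have h1 := ((y + x).summable_self.sub y.summable_self).sub x.summable_self
  have h2 := ((y + Complex.I • x).summable_self.sub y.summable_self).sub x.summable_self
  refine ((h1.add (h2.const_smul Complex.I)).const_smul (1 / 2 : ℂ)).congr fun k => ?_
  simp only [coord_add, coord_smul_complex, star_add, star_smul, add_mul, mul_add,
    smul_mul_assoc, mul_smul_comm, smul_add, smul_sub, smul_smul]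
  simp only [RCLike.star_def, Complex.conj_I]
  match_scalars <;> norm_num

/-- `⟪x, y⟫ = ∑ y k * star (x k)`, and `‖x‖ = ‖⟪x, x⟫‖ ^ (1/2)`. -/
noncomputable instance : Inner A (StdModule A) where
  inner x y := ∑' k, y.coord k * star (x.coord k)

theorem inner_def (x y : StdModule A) :
    inner A x y = ∑' k, y.coord k * star (x.coord k) := rfl

noncomputable instance : Norm (StdModule A) := CStarModule.norm A

noncomputable instance : CStarModule A (StdModule A) where
  inner_add_right {x y z} := by
    simp only [inner_def, coord_add, add_mul]
    exact (summable_inner x y).tsum_add (summable_inner x z)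
  inner_self_nonneg {x} := tsum_nonneg fun k => mul_star_self_nonneg _
  inner_self {x} := by
    constructor
    · intro h
      have h0 : HasSum (fun k => x.coord k * star (x.coord k)) 0 := by
        have := x.summable_self.hasSum
        rwa [← inner_def, h] at this
      rw [hasSum_zero_iff_of_nonneg fun k => mul_star_self_nonneg _] at h0
      ext k
      exact (CStarRing.mul_star_self_eq_zero_iff _).1 (congrFun h0 k)
    · rintro rfl
      simp [inner_def]
  inner_op_smul_right {a x y} := by
    simp only [inner_def, coord_smul, mul_assoc]
    exact (summable_inner x y).tsum_mul_left a
  inner_smul_right_complex {z x y} := by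
    simp only [inner_def, coord_smul_complex, smul_mul_assoc]
    exact (summable_inner x y).tsum_const_smul z
  star_inner x y := by
    simp only [inner_def, tsum_star, star_mul, star_star]
  norm_eq_sqrt_norm_inner_self _ := rfl

noncomputable instance : NormedAddCommGroup (StdModule A) := CStarModule.normedAddCommGroup A

noncomputable instance : NormedSpace ℂ (StdModule A) := .ofCore (CStarModule.normedSpaceCore A)

end StdModule

end StandardModule

section Operators

variable (A : Type*) [CStarAlgebra A] [PartialOrder A] [StarOrderedRing A]
variable {E : Type*} [NormedAddCommGroup E] [NormedSpace ℂ E] [Module A E] [CStarModule A E]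

/-- The set `B^a(E)` of bounded adjointable operators on `E`; such operators are automatically
`A`-linear. -/
def adjointableOperators : Set (E →L[ℂ] E) :=
  {F | ∃ G : E →L[ℂ] E, ∀ x y : E, inner A (F x) y = inner A x (G y)}

/-- Bounded below. -/
def IsBoundedBelowOp (D : E →L[ℂ] E) : Prop :=
  ∃ c : ℝ, 0 < c ∧ ∀ x : E, c * ‖x‖ ≤ ‖D x‖

theorem norm_smul_le_cstarModule (a : A) (x : E) : ‖a • x‖ ≤ ‖a‖ * ‖x‖ := by
  rw [← pow_le_pow_iff_left₀ (norm_nonneg _) (by positivity) two_ne_zero, mul_pow,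
    CStarModule.norm_sq_eq A (x := a • x), CStarModule.norm_sq_eq A (x := x),
    CStarModule.inner_op_smul_right,
    CStarModule.inner_op_smul_left]
  calc ‖a * (inner A x x * star a)‖ ≤ ‖a‖ * (‖inner A x x‖ * ‖star a‖) :=
        (norm_mul_le _ _).trans (by gcongr; exact norm_mul_le _ _)
    _ = ‖a‖ ^ 2 * ‖inner A x x‖ := by rw [norm_star]; ring

/-- The elementary operator `θ_{x,y} : z ↦ ⟪y, z⟫ x`. -/
noncomputable def elementaryOperator [IsScalarTower ℂ A E] (x y : E) : E →L[ℂ] E :=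
  LinearMap.mkContinuous
    { toFun := fun z => inner A y z • x
      map_add' := fun z w => by rw [CStarModule.inner_add_right, add_smul]
      map_smul' := fun c z => by
        rw [CStarModule.inner_smul_right_complex, smul_assoc, RingHom.id_apply] }
    (‖y‖ * ‖x‖) fun z => by
      refine (norm_smul_le_cstarModule A (inner A y z) x).trans ?_
      calc ‖inner A y z‖ * ‖x‖ ≤ (‖y‖ * ‖z‖) * ‖x‖ := by
            gcongr
            exact CStarModule.norm_inner_le E
        _ = ‖y‖ * ‖x‖ * ‖z‖ := by ring

/-- The compact operators `K(E)` in the sense of Hilbert `C⋆`-modules: the operator norm closure of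
the linear span of the elementary operators. -/
noncomputable def compactOperators (E : Type*) [NormedAddCommGroup E] [NormedSpace ℂ E]
    [Module A E] [CStarModule A E] [IsScalarTower ℂ A E] : Submodule ℂ (E →L[ℂ] E) :=
  (Submodule.span ℂ
    (Set.range fun p : E × E => elementaryOperator A p.1 p.2)).topologicalClosure

variable {A}

/-- `N ≼ N'`: `N` is isomorphic (by a bounded `A`-linear map with bounded inverse) to a closed
submodule of `N'`. -/
def IsEmbeddable (N N' : Submodule A E) : Prop :=
  ∃ P : Submodule A E, P ≤ N' ∧ IsClosed (P : Set E) ∧ Nonempty (N ≃L[A] P)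

/-- `E = M ⊕ N` (algebraically direct, not necessarily orthogonal) with closed submodules. -/
def IsClosedDecomposition (M N : Submodule A E) : Prop :=
  IsClosed (M : Set E) ∧ IsClosed (N : Set E) ∧ IsCompl M N

/-- With respect to `E = M₁ ⊕ N₁ → M₂ ⊕ N₂ = E` the operator `F` is diagonal, and its first entry
`F₁ : M₁ → M₂` is an isomorphism. -/
def IsDiagonalWithIso (F : E →L[ℂ] E) (M₁ N₁ M₂ N₂ : Submodule A E) : Prop :=
  (∃ F₁ : M₁ ≃L[A] M₂, ∀ x : M₁, F x = F₁ x) ∧ ∀ x ∈ N₁, F x ∈ N₂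

variable (A)

/-- The class `MΦ₊⁻′(E)`. -/
def mPhiPlusMinusPrime : Set (E →L[ℂ] E) :=
  {F | F ∈ adjointableOperators A ∧ ∃ M₁ N₁ M₂ N₂ : Submodule A E,
    IsClosedDecomposition M₁ N₁ ∧ IsClosedDecomposition M₂ N₂ ∧
    IsDiagonalWithIso F M₁ N₁ M₂ N₂ ∧ N₁.FG ∧ IsEmbeddable N₁ N₂}

end Operators

/-! From 1 to 2: let ι embed N₁ into N₂. A finitely generated closed N₁ is the range of a
finite-rank idempotent R = ∑ θ_{sᵢ,gᵢ}: the frame operator z ↦ ∑ ⟪gᵢ, z⟫ gᵢ of its generators is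
positive and bounded below on N₁, hence invertible there. So K = (F - ι)R is compact, and D = F - K
= F(1 - R) + ιR. The projection onto M₂ along N₂ kills ιRx and sees only F₁ on the rest, so Dx
controls x - Rx; then it controls ιRx, hence Rx.

From 2 to 1: for the coordinate projections Pₙ, ‖K(1 - Pₙ)‖ → 0. For large n, D₁ = D + K(1 - Pₙ) is
still bounded below, and F = D₁ on ker Pₙ, because F - D₁ = KPₙ. As D₁*D₁ is positive and bounded
below, D₁ has a left inverse L. Take M₁ = ker Pₙ and M₂ = D₁M₁; shearing range Pₙ into a graph N₁
makes F diagonal.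

Both invertibility claims use a continuity method: adding t ≥ 0 to a positive operator does not
decrease norms. -/

set_option linter.unusedSectionVars false

/-! ### Invertibility by continuation -/

section BanachSpace

variable {X : Type*} [NormedAddCommGroup X] [NormedSpace ℂ X] [CompleteSpace X]

/-- The lower bound gives the inverse at s norm at most 1/c, so a Neumann series covers a radius c
that does not depend on s. -/
theorem isUnit_add_smul_of_abs_sub_lt {G : X →L[ℂ] X} {c s t : ℝ} (hc : 0 < c)
    (h : ∀ x, c * ‖x‖ ≤ ‖G x + (s : ℂ) • x‖) (hs : IsUnit (G + (s : ℂ) • 1))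
    (hst : |s - t| < c) : IsUnit (G + (t : ℂ) • 1) := by
  obtain ⟨u, hu⟩ := hs
  set R : X →L[ℂ] X := ↑u⁻¹ with hR
  have hinv : (G + (s : ℂ) • 1) * R = 1 := by rw [← hu]; exact u.mul_inv
  have hRnorm : ‖R‖ ≤ c⁻¹ := by
    refine R.opNorm_le_bound (by positivity) fun x => ?_
    have h1 := h (R x)
    have h2 : G (R x) + (s : ℂ) • R x = x := congrArg (fun T : X →L[ℂ] X => T x) hinv
    rw [h2] at h1
    rwa [inv_mul_eq_div, le_div_iff₀ hc, mul_comm]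
  have hsmall : ‖((s - t : ℝ) : ℂ) • R‖ < 1 := by
    rw [norm_smul, Complex.norm_real, Real.norm_eq_abs]
    calc |s - t| * ‖R‖ ≤ |s - t| * c⁻¹ := by gcongr
      _ < c * c⁻¹ := by gcongr
      _ = 1 := mul_inv_cancel₀ hc.ne'
  have hfac : G + (t : ℂ) • 1 = (G + (s : ℂ) • 1) * (1 - ((s - t : ℝ) : ℂ) • R) := by
    rw [mul_sub, mul_smul_comm, hinv, mul_one]
    push_cast
    module
  rw [hfac, ← hu]
  exact u.isUnit.mul (isUnit_one_sub_of_norm_lt_one hsmall)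

/-- Continuity method: if the operators `G + t`, `t ≥ 0`, are bounded below uniformly in `t`,
then `G` is invertible. -/
theorem isUnit_of_forall_nonneg_le_norm_add_smul {G : X →L[ℂ] X} {c : ℝ} (hc : 0 < c)
    (h : ∀ t : ℝ, 0 ≤ t → ∀ x, c * ‖x‖ ≤ ‖G x + (t : ℂ) • x‖) : IsUnit G := by
  -- Beyond ‖G‖ a Neumann series applies; from there N steps of length t₀/N < c descend to 0.
  set t₀ : ℝ := ‖G‖ + 1 with ht₀
  have ht₀pos : 0 < t₀ := by positivity
  obtain ⟨N, hN⟩ := exists_nat_gt (t₀ / c)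
  have hNpos : (0 : ℝ) < N := (by positivity : 0 < t₀ / c).trans hN
  have hstep : t₀ / N < c := by
    rw [div_lt_iff₀ hc] at hN
    rw [div_lt_iff₀ hNpos, mul_comm]
    exact hN
  have hstart : IsUnit (G + (t₀ : ℂ) • 1) := by
    have hne : (t₀ : ℂ) ≠ 0 := by exact_mod_cast ht₀pos.ne'
    have h1 : ‖-((t₀ : ℂ)⁻¹ • G)‖ < 1 := by
      rw [norm_neg, norm_smul, norm_inv, Complex.norm_real, Real.norm_of_nonneg ht₀pos.le,
        inv_mul_lt_iff₀ ht₀pos]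
      linarith
    have h2 := (isUnit_one_sub_of_norm_lt_one h1).smul (Units.mk0 _ hne)
    convert h2 using 1
    rw [Units.smul_def, Units.val_mk0, sub_neg_eq_add, smul_add, smul_smul, mul_inv_cancel₀ hne,
      one_smul, add_comm]
  have key : ∀ k : ℕ, k ≤ N → IsUnit (G + ((t₀ * (1 - k / N) : ℝ) : ℂ) • 1) := by
    intro k
    induction k with
    | zero => intro _; simpa using hstart
    | succ k ih =>
      intro hk
      have hk' : (k : ℝ) / N ≤ 1 := by
        rw [div_le_one hNpos]
        exact_mod_cast (Nat.le_succ k).trans hk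
      refine isUnit_add_smul_of_abs_sub_lt hc (h _ (mul_nonneg ht₀pos.le (by linarith)))
        (ih (by omega)) ?_
      have : t₀ * (1 - k / N) - t₀ * (1 - ((k + 1 : ℕ) : ℝ) / N) = t₀ / N := by
        push_cast
        field_simp
        ring
      rwa [this, abs_of_pos (by positivity)]
  have := key N le_rfl
  rwa [div_self hNpos.ne', sub_self, mul_zero, Complex.ofReal_zero, zero_smul, add_zero] at this

end BanachSpace

/-! ### Adjointable and finite-rank operators; from the decomposition to bounded below plus compact
-/

section HilbertModule

variable {A : Type*} [CStarAlgebra A] [PartialOrder A] [StarOrderedRing A]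
variable {E : Type*} [NormedAddCommGroup E] [NormedSpace ℂ E] [Module A E] [CStarModule A E]

theorem ext_inner_cstarModule {x y : E} (h : ∀ z : E, inner A x z = inner A y z) : x = y := by
  rw [← sub_eq_zero, ← CStarModule.inner_self (A := A), CStarModule.inner_sub_left, h, sub_self]

/-- Operators are typed as ℂ-linear; their A-linearity is recovered from the adjoint relation. -/
theorem map_smul_of_adjoint {F G : E → E} (h : ∀ x y : E, inner A (F x) y = inner A x (G y))
    (a : A) (x : E) : F (a • x) = a • F x :=
  ext_inner_cstarModule (A := A) fun z => by
    rw [h, CStarModule.inner_op_smul_left, CStarModule.inner_op_smul_left, h]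

theorem inner_adjoint_symm {F G : E → E} (h : ∀ x y : E, inner A (F x) y = inner A x (G y))
    (x y : E) : inner A (G x) y = inner A x (F y) := by
  rw [← CStarModule.star_inner, ← h, CStarModule.star_inner]

theorem adjointableOperators.sub {F G : E →L[ℂ] E} (hF : F ∈ adjointableOperators A)
    (hG : G ∈ adjointableOperators A) : F - G ∈ adjointableOperators A := by
  obtain ⟨F', hF'⟩ := hF
  obtain ⟨G', hG'⟩ := hG
  exact ⟨F' - G', fun x y => by simp [hF', hG']⟩

theorem adjointableOperators.sum {ι : Type*} (s : Finset ι) {F : ι → E →L[ℂ] E}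
    (hF : ∀ i ∈ s, F i ∈ adjointableOperators A) : ∑ i ∈ s, F i ∈ adjointableOperators A := by
  choose! G hG using hF
  refine ⟨∑ i ∈ s, G i, fun x y => ?_⟩
  simp only [sum_apply, CStarModule.inner_sum_left,
    CStarModule.inner_sum_right]
  exact Finset.sum_congr rfl fun i hi => hG i hi x y

/-- If `⟪x, y⟫ ≥ 0`, then `‖y‖ ≤ ‖y + t x‖` for all `t ≥ 0`. -/
theorem norm_le_norm_add_smul_of_nonneg {x y : E} (h : 0 ≤ inner A x y) {t : ℝ} (ht : 0 ≤ t) :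
    ‖y‖ ≤ ‖y + (t : ℂ) • x‖ := by
  rw [← pow_le_pow_iff_left₀ (norm_nonneg _) (norm_nonneg _) two_ne_zero,
    CStarModule.norm_sq_eq A, CStarModule.norm_sq_eq A]
  refine CStarAlgebra.norm_le_norm_of_nonneg_of_le CStarModule.inner_self_nonneg ?_
  -- Positive elements are self-adjoint, so both cross terms are positive and the expanded square
  -- dominates ⟪y, y⟫.
  have h' : inner A y x = inner A x y := by
    rw [← CStarModule.star_inner, (IsSelfAdjoint.of_nonneg h).star_eq]
  have ht' : (0 : ℂ) ≤ (t : ℂ) := by exact_mod_cast ht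
  simp only [CStarModule.inner_add_left, CStarModule.inner_add_right,
    CStarModule.inner_smul_right_complex, CStarModule.inner_smul_left_complex, h',
    RCLike.star_def, Complex.conj_ofReal, add_assoc]
  refine le_add_of_nonneg_right (add_nonneg (smul_nonneg ht' h)
    (smul_nonneg ht' (add_nonneg h (smul_nonneg ht' ?_))))
  exact CStarModule.inner_self_nonneg

/-- A closed decomposition is topological. -/
theorem IsClosedDecomposition.exists_projection [IsScalarTower ℂ A E] [CompleteSpace E]
    {M N : Submodule A E} (h : IsClosedDecomposition M N) :
    ∃ q : E →L[ℂ] E, (∀ x, q x ∈ M) ∧ (∀ x, x - q x ∈ N) ∧ (∀ x ∈ M, q x = x) ∧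
      ∀ x ∈ N, q x = 0 := by
  obtain ⟨hM, hN, hMN⟩ := h
  have hc : IsCompl (M.restrictScalars ℂ) (N.restrictScalars ℂ) := by
    refine ⟨?_, ?_⟩
    · rw [Submodule.disjoint_def]
      exact (Submodule.disjoint_def (p := M)).1 hMN.disjoint
    · rw [Submodule.codisjoint_iff_exists_add_eq]
      exact (Submodule.codisjoint_iff_exists_add_eq (p := M)).1 hMN.codisjoint
  have ht : Submodule.IsTopCompl (M.restrictScalars ℂ) (N.restrictScalars ℂ) :=
    Submodule.isTopCompl_iff_isCompl_isClosed.2 ⟨hc, hM, hN⟩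
  refine ⟨Submodule.projectionL _ _ ht, fun x => Submodule.projectionL_apply_mem ht x,
    fun x => ?_, fun x hx => Submodule.projectionL_apply_left ht ⟨x, hx⟩,
    fun x hx => Submodule.projectionL_apply_right ht ⟨x, hx⟩⟩
  have := Submodule.projectionL_apply_mem ht.symm x
  rwa [Submodule.projectionL_eq_self_sub_projectionL] at this

variable [IsScalarTower ℂ A E]

@[simp]
theorem elementaryOperator_apply (x y z : E) :
    elementaryOperator A x y z = inner A y z • x := rfl

theorem inner_elementaryOperator (x y z w : E) :
    inner A (elementaryOperator A x y z) w = inner A z (elementaryOperator A y x w) := by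
  simp only [elementaryOperator_apply, CStarModule.inner_op_smul_left,
    CStarModule.inner_op_smul_right, CStarModule.star_inner]

theorem inner_sum_elementaryOperator_self {ι : Type*} (s : Finset ι) (e : ι → E) (x y : E) :
    inner A ((∑ i ∈ s, elementaryOperator A (e i) (e i)) x) y =
      inner A x ((∑ i ∈ s, elementaryOperator A (e i) (e i)) y) := by
  simp only [sum_apply, CStarModule.inner_sum_left, CStarModule.inner_sum_right,
    inner_elementaryOperator]

omit [IsScalarTower ℂ A E] in
theorem inner_sum_smul_right {ι : Type*} (s : Finset ι) (a : ι → A) (e : ι → E) (y : E) :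
    inner A y (∑ i ∈ s, a i • e i) = ∑ i ∈ s, a i * inner A y (e i) := by
  simp only [CStarModule.inner_sum_right, CStarModule.inner_op_smul_right]

/-- Moving 1 - P across the inner product reduces operator-norm decay to decay of the single vector
y - Py. -/
theorem elementaryOperator_mul_one_sub {P : E →L[ℂ] E}
    (hP : ∀ x y : E, inner A (P x) y = inner A x (P y)) (x y : E) :
    elementaryOperator A x y * (1 - P) = elementaryOperator A x (y - P y) := by
  ext1 z
  change inner A y (z - P z) • x = inner A (y - P y) z • x
  rw [CStarModule.inner_sub_right, CStarModule.inner_sub_left, hP]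

theorem adjointableOperators.add_mul_one_sub {D K P : E →L[ℂ] E}
    (hD : D ∈ adjointableOperators A) (hK : K ∈ adjointableOperators A)
    (hP : ∀ x y : E, inner A (P x) y = inner A x (P y)) :
    D + K * (1 - P) ∈ adjointableOperators A := by
  obtain ⟨D', hD'⟩ := hD
  obtain ⟨K', hK'⟩ := hK
  refine ⟨D' + (1 - P) * K', fun x y => ?_⟩
  change inner A (D x + K (x - P x)) y = inner A x (D' y + (K' y - P (K' y)))
  rw [CStarModule.inner_add_left, CStarModule.inner_add_right, hD', hK',
    CStarModule.inner_sub_left, CStarModule.inner_sub_right, hP]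

theorem elementaryOperator_mem_adjointableOperators (x y : E) :
    elementaryOperator A x y ∈ adjointableOperators A :=
  ⟨elementaryOperator A y x, inner_elementaryOperator x y⟩

theorem elementaryOperator_mem_compactOperators (x y : E) :
    elementaryOperator A x y ∈ compactOperators A E :=
  Submodule.le_topologicalClosure _ (Submodule.subset_span ⟨(x, y), rfl⟩)

/-- Coefficients with respect to finitely many generators of a complete module can be chosen
with norm controlled by the element. -/
theorem exists_norm_le_mul_sum_norm_inner [CompleteSpace E] {N : Submodule A E}
    (hN : IsClosed (N : Set E)) {n : ℕ} {g : Fin n → E} (hg : Submodule.span A (Set.range g) = N) :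
    ∃ C > 0, ∀ z ∈ N, ‖z‖ ≤ C * ∑ i, ‖inner A (g i) z‖ := by
  have hgN : ∀ i, g i ∈ N := fun i => hg ▸ Submodule.subset_span ⟨i, rfl⟩
  have : CompleteSpace N := hN.completeSpace_coe
  let T : (Fin n → A) →L[ℂ] N := LinearMap.mkContinuous
    { toFun := fun a => ⟨∑ i, a i • g i, N.sum_mem fun i _ => N.smul_mem _ (hgN i)⟩
      map_add' := fun a b => Subtype.ext <| by simp [add_smul, Finset.sum_add_distrib]
      map_smul' := fun c a => Subtype.ext <| by simp [Finset.smul_sum] }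
    (∑ i, ‖g i‖) fun a => by
      rw [Finset.sum_mul]
      change ‖∑ i, a i • g i‖ ≤ _
      refine (norm_sum_le _ _).trans (Finset.sum_le_sum fun i _ => ?_)
      refine (norm_smul_le_cstarModule A _ _).trans ?_
      rw [mul_comm]
      gcongr
      exact norm_le_pi_norm a i
  have hT : Function.Surjective T := by
    rintro ⟨z, hz⟩
    rw [← hg] at hz
    obtain ⟨a, rfl⟩ := (Submodule.mem_span_range_iff_exists_fun A).1 hz
    exact ⟨a, rfl⟩
  -- Open mapping theorem for the synthesis map a ↦ ∑ aᵢ gᵢ onto the Banach space N.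
  obtain ⟨C, hC, h⟩ := T.exists_preimage_norm_le hT
  refine ⟨C, hC, fun z hz => ?_⟩
  obtain ⟨a, ha, hna⟩ := h ⟨z, hz⟩
  have hz' : ∑ i, a i • g i = z := congrArg Subtype.val ha
  rcases eq_or_ne z 0 with rfl | hz0
  · simp
  have hpos : 0 < ‖z‖ := norm_pos_iff.2 hz0
  have h1 : inner A z z = ∑ i, a i * inner A z (g i) := by
    nth_rw 2 [← hz']
    rw [CStarModule.inner_sum_right]
    simp only [CStarModule.inner_op_smul_right]
  refine le_of_mul_le_mul_right ?_ hpos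
  calc ‖z‖ * ‖z‖ = ‖inner A z z‖ := by rw [← sq, CStarModule.norm_sq_eq A]
    _ ≤ ∑ i, ‖a i‖ * ‖inner A (g i) z‖ := by
      rw [h1]
      refine (norm_sum_le _ _).trans (Finset.sum_le_sum fun i _ => ?_)
      rw [← norm_star (inner A (g i) z), CStarModule.star_inner]
      exact norm_mul_le _ _
    _ ≤ ∑ i, (C * ‖z‖) * ‖inner A (g i) z‖ := by
      gcongr with i
      exact (norm_le_pi_norm a i).trans hna
    _ = C * (∑ i, ‖inner A (g i) z‖) * ‖z‖ := by rw [← Finset.mul_sum]; ring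

/-- A finitely generated closed submodule of a Hilbert module is the range of an adjointable
idempotent of finite rank. -/
theorem Submodule.FG.exists_forall_sum_inner_smul_eq [CompleteSpace E] {N : Submodule A E}
    (hN : IsClosed (N : Set E)) (hfg : N.FG) :
    ∃ (n : ℕ) (g s : Fin n → E), (∀ i, s i ∈ N) ∧ ∀ z ∈ N, ∑ i, inner A (g i) z • s i = z := by
  obtain ⟨n, g, hg⟩ := Submodule.fg_iff_exists_fin_generating_family.1 hfg
  have hgN : ∀ i, g i ∈ N := fun i => hg ▸ Submodule.subset_span ⟨i, rfl⟩
  have : CompleteSpace N := hN.completeSpace_coe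
  obtain ⟨C, hC, hbound⟩ := exists_norm_le_mul_sum_norm_inner hN hg
  -- The frame operator of the generators; the dual family will be sᵢ = G⁻¹gᵢ.
  let G : N →L[ℂ] N :=
    ((∑ i, elementaryOperator A (g i) (g i)).comp (N.restrictScalars ℂ).subtypeL).codRestrict
      (N.restrictScalars ℂ) fun z => by
        simpa using N.sum_mem fun i _ => N.smul_mem (inner A (g i) (z : E)) (hgN i)
  have hG : ∀ z : N, (G z : E) = ∑ i, inner A (g i) (z : E) • g i := fun z => by
    change (∑ i, elementaryOperator A (g i) (g i)) (z : E) = _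
    simp
  have hinner : ∀ z : N, inner A (z : E) (G z : E) =
      ∑ i, inner A (g i) (z : E) * star (inner A (g i) (z : E)) := fun z => by
    rw [hG, CStarModule.inner_sum_right]
    simp only [CStarModule.inner_op_smul_right, CStarModule.star_inner]
  have hpos : ∀ z : N, 0 ≤ inner A (z : E) (G z : E) := fun z => by
    rw [hinner]
    exact Finset.sum_nonneg fun i _ => mul_star_self_nonneg _
  -- One positive summand is dominated by the whole sum ⟪z, Gz⟫, to which Cauchy–Schwarz applies.
  have hcoef : ∀ (z : N) i, ‖inner A (g i) (z : E)‖ ^ 2 ≤ ‖z‖ * ‖G z‖ := fun z i => by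
    refine le_trans ?_ (CStarModule.norm_inner_le (A := A) E (x := (z : E)) (y := (G z : E)))
    rw [sq, ← CStarRing.norm_self_mul_star, hinner]
    exact CStarAlgebra.norm_le_norm_of_nonneg_of_le (mul_star_self_nonneg _)
      (Finset.single_le_sum (f := fun i => inner A (g i) (z : E) * star (inner A (g i) (z : E)))
        (fun i _ => mul_star_self_nonneg _) (Finset.mem_univ i))
  have hlower : ∀ z : N, ‖z‖ ≤ (C * n) ^ 2 * ‖G z‖ := fun z => by
    rcases eq_or_ne z 0 with rfl | hz0
    · simp
    have hz : 0 < ‖z‖ := norm_pos_iff.2 hz0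
    have h1 : ‖z‖ ≤ C * (n * √(‖z‖ * ‖G z‖)) := by
      refine (hbound z z.2).trans ?_
      gcongr
      refine (Finset.sum_le_card_nsmul _ _ _ fun i _ => Real.le_sqrt_of_sq_le (hcoef z i)).trans ?_
      simp
    have h2 : ‖z‖ ^ 2 ≤ (C * n) ^ 2 * (‖z‖ * ‖G z‖) := by
      calc ‖z‖ ^ 2 ≤ (C * (n * √(‖z‖ * ‖G z‖))) ^ 2 := by gcongr
        _ = (C * n) ^ 2 * √(‖z‖ * ‖G z‖) ^ 2 := by ring
        _ = _ := by rw [Real.sq_sqrt (by positivity)]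
    refine le_of_mul_le_mul_right ?_ hz
    nlinarith
  have hunit : IsUnit G := by
    -- The summand 1 keeps the constant positive when n = 0.
    refine isUnit_of_forall_nonneg_le_norm_add_smul (c := ((C * n) ^ 2 + 1)⁻¹) (by positivity)
      fun t ht x => ?_
    have h1 : ‖G x‖ ≤ ‖G x + (t : ℂ) • x‖ :=
      norm_le_norm_add_smul_of_nonneg (A := A) (E := E) (hpos x) ht
    refine le_trans ?_ h1
    rw [inv_mul_le_iff₀ (by positivity)]
    have := hlower x
    have := norm_nonneg (G x)
    linarith
  obtain ⟨u, hu⟩ := hunit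
  have hinj : Function.Injective G := (ContinuousLinearMap.isUnit_iff_bijective.1 ⟨u, hu⟩).1
  have hS : ∀ z : N, G ((↑u⁻¹ : N →L[ℂ] N) z) = z := fun z => by
    rw [← hu]
    exact congrArg (fun T : N →L[ℂ] N => T z) u.mul_inv
  refine ⟨n, g, fun i => ((↑u⁻¹ : N →L[ℂ] N) ⟨g i, hgN i⟩ : N), fun i => Subtype.prop _,
    fun z hz => ?_⟩
  have hGsmul : ∀ (a : A) (z : N), G (a • z) = a • G z := fun a z => Subtype.ext <| by
    simp [hG, CStarModule.inner_op_smul_right, Finset.smul_sum, mul_smul]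
  -- Comparing images under G uses only the A-linearity of G, not of its inverse.
  have key : ∑ i, inner A (g i) z • ((↑u⁻¹ : N →L[ℂ] N) ⟨g i, hgN i⟩) = (⟨z, hz⟩ : N) := by
    apply hinj
    rw [map_sum]
    simp only [hGsmul, hS]
    exact Subtype.ext (by simp [hG])
  simpa using congrArg Subtype.val key

/-- If `F` is diagonal with invertible first entry, with `N₁` finitely generated and embeddable in
`N₂`, then `F` is bounded below up to a compact operator. -/
theorem exists_isBoundedBelowOp_add_compact_of_mem_mPhiPlusMinusPrime [CompleteSpace E]
    {F : E →L[ℂ] E} (hF : F ∈ mPhiPlusMinusPrime A) :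
    ∃ D K : E →L[ℂ] E, D ∈ adjointableOperators A ∧ IsBoundedBelowOp D ∧
      K ∈ compactOperators A E ∧ F = D + K := by
  obtain ⟨hFadj, M₁, N₁, M₂, N₂, h₁, h₂, ⟨⟨F₁, hF₁⟩, hFN⟩, hfg, P, hPN, -, ⟨ι⟩⟩ := hF
  obtain ⟨n, g, s, hsN, hs⟩ := hfg.exists_forall_sum_inner_smul_eq h₁.2.1
  obtain ⟨π, hπM, hπN, hπid, hπ0⟩ := h₁.exists_projection
  obtain ⟨q, hqM, hqN, hqid, hq0⟩ := h₂.exists_projection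
  obtain ⟨F', hF'⟩ := id hFadj
  have hFsmul : ∀ (a : A) (x : E), F (a • x) = a • F x := map_smul_of_adjoint hF'
  -- `R` is an idempotent onto `N₁`
  set R : E →L[ℂ] E := ∑ i, elementaryOperator A (s i) (g i) with hR
  have hRapp : ∀ z, R z = ∑ i, inner A (g i) z • s i := fun z => by simp [hR]
  have hRmem : ∀ z, R z ∈ N₁ := fun z => by
    rw [hRapp]
    exact N₁.sum_mem fun i _ => N₁.smul_mem _ (hsN i)
  have hRid : ∀ z ∈ N₁, R z = z := fun z hz => by rw [hRapp, hs z hz]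
  -- This is (F - ι)R, spelled out as a finite sum so that compactness and adjointability are
  -- immediate.
  set K : E →L[ℂ] E := ∑ i, elementaryOperator A (F (s i) - ι ⟨s i, hsN i⟩) (g i) with hK
  have hKapp : ∀ z, K z = F (R z) - ι ⟨R z, hRmem z⟩ := fun z => by
    have h1 : (⟨R z, hRmem z⟩ : N₁) = ∑ i, inner A (g i) z • (⟨s i, hsN i⟩ : N₁) :=
      Subtype.ext (by simp [hRapp])
    rw [h1, map_sum, hRapp, map_sum, hK]
    simp only [map_smul]
    simp [hFsmul, smul_sub]
  refine ⟨F - K, K, adjointableOperators.sub hFadj (adjointableOperators.sum _ fun i _ =>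
    elementaryOperator_mem_adjointableOperators _ _), ?_, Submodule.sum_mem _ fun i _ =>
    elementaryOperator_mem_compactOperators _ _, by simp⟩
  obtain ⟨c₁, hc₁, hb₁⟩ : ∃ c > 0, ∀ x ∈ M₁, ‖x‖ ≤ c * ‖F x‖ := by
    obtain ⟨C, hC, h⟩ := ((F₁.symm : M₂ →L[A] M₁).restrictScalars ℂ).bound
    refine ⟨C, hC, fun x hx => ?_⟩
    have := h (F₁ ⟨x, hx⟩)
    simpa [hF₁ ⟨x, hx⟩] using this
  obtain ⟨c₂, hc₂, hb₂⟩ : ∃ c > 0, ∀ x : N₁, ‖x‖ ≤ c * ‖ι x‖ := by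
    obtain ⟨C, hC, h⟩ := ((ι.symm : P →L[A] N₁).restrictScalars ℂ).bound
    refine ⟨C, hC, fun x => ?_⟩
    simpa using h (ι x)
  set D := F - K with hD
  have hDapp : ∀ x, D x = F (x - R x) + ι ⟨R x, hRmem x⟩ := fun x => by
    rw [hD, sub_apply, hKapp, map_sub]
    abel
  -- the part of `x` in `ker R`
  have hker : ∀ x, ‖x - R x‖ ≤ ‖1 - R‖ * (c₁ * (‖q‖ * ‖D x‖)) := fun x => by
    set y := x - R x with hy
    have hRy : R y = 0 := by rw [hy, map_sub, hRid _ (hRmem x), sub_self]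
    -- Both ι(Rx) and F(y - πy) lie in N₂, the kernel of q.
    have hqF : q (D x) = F (π y) := by
      have h1 : F y = F (π y) + F (y - π y) := by rw [← map_add]; congr 1; abel
      have h2 : F (π y) ∈ M₂ := by
        rw [hF₁ ⟨π y, hπM y⟩]
        exact Subtype.prop _
      rw [hDapp, map_add, hq0 _ (hPN (Subtype.prop _)), add_zero, h1, map_add,
        hq0 _ (hFN _ (hπN y)), add_zero, hqid _ h2]
    -- The kernel of R need not be M₁, but y - πy lies in N₁ and is fixed by R, while Ry = 0.
    have hy' : y = (1 - R) (π y) := by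
      have h1 := hRid _ (hπN y)
      rw [map_sub, hRy, zero_sub] at h1
      have h2 : R (π y) = π y - y := by rw [← neg_sub y, ← h1, neg_neg]
      rw [sub_apply, h2, one_apply_eq_self, sub_sub_cancel]
    calc ‖y‖ = ‖(1 - R) (π y)‖ := congrArg _ hy'
      _ ≤ ‖1 - R‖ * ‖π y‖ := ContinuousLinearMap.le_opNorm _ _
      _ ≤ ‖1 - R‖ * (c₁ * ‖F (π y)‖) := by gcongr; exact hb₁ _ (hπM y)
      _ ≤ ‖1 - R‖ * (c₁ * (‖q‖ * ‖D x‖)) := by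
        rw [← hqF]
        gcongr
        exact ContinuousLinearMap.le_opNorm _ _
  set B : ℝ := ‖1 - R‖ * (c₁ * ‖q‖) with hB
  have hB0 : 0 ≤ B := by positivity
  have hker' : ∀ x, ‖x - R x‖ ≤ B * ‖D x‖ := fun x => (hker x).trans_eq (by rw [hB]; ring)
  -- The bound on x - Rx controls ι(Rx) = Dx - F(x - Rx), and ι is bounded below.
  have hran : ∀ x, ‖R x‖ ≤ c₂ * (1 + ‖F‖ * B) * ‖D x‖ := fun x => by
    have h1 : ((ι ⟨R x, hRmem x⟩ : P) : E) = D x - F (x - R x) := by rw [hDapp]; abel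
    calc ‖R x‖ ≤ c₂ * ‖((ι ⟨R x, hRmem x⟩ : P) : E)‖ := hb₂ ⟨R x, hRmem x⟩
      _ ≤ c₂ * (‖D x‖ + ‖F‖ * (B * ‖D x‖)) := by
        rw [h1]
        gcongr
        refine (norm_sub_le _ _).trans ?_
        gcongr
        exact (F.le_opNorm _).trans (by gcongr; exact hker' x)
      _ = c₂ * (1 + ‖F‖ * B) * ‖D x‖ := by ring
  refine ⟨(B + c₂ * (1 + ‖F‖ * B))⁻¹, by positivity, fun x => ?_⟩
  rw [inv_mul_le_iff₀ (by positivity), add_mul]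
  calc ‖x‖ = ‖(x - R x) + R x‖ := by rw [sub_add_cancel]
    _ ≤ _ := (norm_add_le _ _).trans (add_le_add (hker' x) (hran x))

end HilbertModule

/-! ### Decompositions from left invertible operators -/

section Decomposition

variable {A : Type*} [CStarAlgebra A] [PartialOrder A] [StarOrderedRing A]
variable {E : Type*} [NormedAddCommGroup E] [NormedSpace ℂ E] [Module A E] [CStarModule A E]

/-- The left inverse cuts the image out by two closed conditions, Ly ∈ M and TLy = y. -/
theorem isClosed_map_of_leftInvOn {T L : E →L[A] E} {M : Submodule A E}
    (hM : IsClosed (M : Set E)) (h : ∀ x ∈ M, L (T x) = x) :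
    IsClosed (M.map (T : E →ₗ[A] E) : Set E) := by
  have : (M.map (T : E →ₗ[A] E) : Set E) = L ⁻¹' M ∩ {y | T (L y) = y} := by
    ext y
    constructor
    · rintro ⟨x, hx, rfl⟩
      exact ⟨by simpa [h x hx] using hx, by simp [h x hx]⟩
    · rintro ⟨hy, hy'⟩
      exact ⟨L y, hy, hy'⟩
  rw [this]
  exact (hM.preimage L.continuous).inter
    (isClosed_eq (T.continuous.comp L.continuous) continuous_id)

theorem exists_equiv_map_of_leftInvOn {T L : E →L[A] E} {M : Submodule A E}
    (h : ∀ x ∈ M, L (T x) = x) :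
    ∃ e : M ≃L[A] M.map (T : E →ₗ[A] E), ∀ x : M, T x = e x := by
  have hL : ∀ y ∈ M.map (T : E →ₗ[A] E), L y ∈ M := by
    rintro _ ⟨x, hx, rfl⟩
    simpa [h x hx] using hx
  refine ⟨ContinuousLinearEquiv.equivOfInverse
    ((T.comp M.subtypeL).codRestrict _ fun x => ⟨x, x.2, rfl⟩)
    ((L.comp (M.map (T : E →ₗ[A] E)).subtypeL).codRestrict M fun y => hL y y.2)
    (fun x => Subtype.ext (h x x.2)) ?_, fun x => rfl⟩
  rintro ⟨_, x, hx, rfl⟩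
  exact Subtype.ext (congrArg T (h x hx))

/-- If `F` agrees with the left invertible operator `D` on the kernel of an idempotent `p` with
finitely generated range, then `F` has the decomposition defining `MΦ₊⁻′`. -/
theorem exists_decomposition_of_eqOn_ker {F D L p : E →L[A] E} (hLD : ∀ x, L (D x) = x)
    (hp : ∀ x, p (p x) = p x) (hfg : (LinearMap.range (p : E →ₗ[A] E)).FG)
    (hFD : ∀ x, p x = 0 → F x = D x) :
    ∃ M₁ N₁ M₂ N₂ : Submodule A E,
      IsClosedDecomposition M₁ N₁ ∧ IsClosedDecomposition M₂ N₂ ∧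
      ((∃ F₁ : M₁ ≃L[A] M₂, ∀ x : M₁, F x = F₁ x) ∧ ∀ x ∈ N₁, F x ∈ N₂) ∧
      N₁.FG ∧ IsEmbeddable N₁ N₂ := by
  -- U is the off-diagonal entry of LF from range p to ker p. On the graph {px - Ux} it cancels,
  -- since LF is the identity on ker p; this graph is N₁.
  set U : E →L[A] E := (1 - p).comp (L.comp (F.comp p)) with hU
  have hUapp : ∀ x, U x = L (F (p x)) - p (L (F (p x))) := fun x => by simp [hU]
  have hpU : ∀ x, p (U x) = 0 := fun x => by rw [hUapp, map_sub, hp, sub_self]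
  have hUp : ∀ x, U (p x) = U x := fun x => by rw [hUapp, hp, ← hUapp]
  have hU0 : ∀ x, p x = 0 → U x = 0 := fun x hx => by rw [hUapp, hx]; simp
  -- W is the projection onto ker p along the graph, which is therefore closed as ker W. Likewise DQ
  -- below projects onto D(ker p) along ker Q.
  set W : E →L[A] E := 1 - p + U with hW
  have hWapp : ∀ x, W x = x - p x + U x := fun x => by simp [hW]
  set Q : E →L[A] E := (1 - p).comp L with hQ
  have hQapp : ∀ x, Q x = L x - p (L x) := fun x => by simp [hQ]
  set M₁ : Submodule A E := LinearMap.ker (p : E →ₗ[A] E)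
  set N₁ : Submodule A E := LinearMap.ker (W : E →ₗ[A] E)
  set M₂ : Submodule A E := M₁.map (D : E →ₗ[A] E)
  set N₂ : Submodule A E := LinearMap.ker (Q : E →ₗ[A] E)
  have memM₁ : ∀ x, x ∈ M₁ ↔ p x = 0 := fun x => Iff.rfl
  have memN₁ : ∀ x, x ∈ N₁ ↔ x - p x + U x = 0 := fun x => by rw [← hWapp]; rfl
  have memN₂ : ∀ x, x ∈ N₂ ↔ L x - p (L x) = 0 := fun x => by rw [← hQapp]; rfl
  have hM₁ : IsClosed (M₁ : Set E) := isClosed_singleton.preimage p.continuous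
  have hN₁ : IsClosed (N₁ : Set E) := isClosed_singleton.preimage W.continuous
  have hN₂ : IsClosed (N₂ : Set E) := isClosed_singleton.preimage Q.continuous
  have hN₁eq : ∀ x ∈ N₁, x = p x - U x := fun x hx => by
    rw [memN₁] at hx
    rw [← sub_eq_zero, ← hx]
    abel
  have hmemN₁ : ∀ x, p x - U x ∈ N₁ := fun x => by
    rw [memN₁, map_sub, map_sub, hp, hpU, hUp, hU0 _ (hpU x)]
    abel
  refine ⟨M₁, N₁, M₂, N₂, ⟨hM₁, hN₁, ?_, ?_⟩,
    ⟨isClosed_map_of_leftInvOn hM₁ fun x _ => hLD x, hN₂, ?_, ?_⟩, ⟨?_, ?_⟩, ?_, ?_⟩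
  · refine Submodule.disjoint_def.2 fun x hx hx' => ?_
    rw [memM₁] at hx
    rw [hN₁eq x hx', hx, hU0 x hx, sub_zero]
  · refine Submodule.codisjoint_iff_exists_add_eq.2 fun x =>
      ⟨x - p x + U x, p x - U x, ?_, hmemN₁ x, by abel⟩
    rw [memM₁, map_add, map_sub, hp, hpU, sub_self, add_zero]
  · refine Submodule.disjoint_def.2 ?_
    rintro _ ⟨m, hm, rfl⟩ hx
    have hm' : p m = 0 := hm
    have hx' : L (D m) - p (L (D m)) = 0 := (memN₂ _).1 hx
    rw [hLD, hm', sub_zero] at hx'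
    rw [hx', map_zero]
  · refine Submodule.codisjoint_iff_exists_add_eq.2 fun y =>
      ⟨D (L y - p (L y)), y - D (L y - p (L y)), ⟨_, ?_, rfl⟩, ?_, by abel⟩
    · change p _ = 0
      rw [map_sub, hp, sub_self]
    · rw [memN₂, map_sub, hLD, map_sub, map_sub, hp]
      abel
  · obtain ⟨e, he⟩ := exists_equiv_map_of_leftInvOn (T := D) (L := L) (M := M₁) fun x _ => hLD x
    exact ⟨e, fun x => (hFD x x.2).trans (he x)⟩
  · intro x hx
    rw [memN₂]
    have h1 : L (F x) = L (F (p x)) - U x := by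
      conv_lhs => rw [hN₁eq x hx]
      rw [map_sub, map_sub, hFD _ (hpU x), hLD]
    rw [h1, map_sub, hpU, hUapp]
    abel
  -- The graph inherits generators from range p.
  · have : N₁ = (LinearMap.range (p : E →ₗ[A] E)).map ((1 - U : E →L[A] E) : E →ₗ[A] E) := by
      ext x
      constructor
      · intro hx
        refine ⟨p x, ⟨x, rfl⟩, ?_⟩
        change p x - U (p x) = x
        rw [hUp, ← hN₁eq x hx]
      · rintro ⟨_, ⟨y, rfl⟩, rfl⟩
        change p y - U (p y) ∈ N₁
        rw [hUp]
        exact hmemN₁ y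
    rw [this]
    exact hfg.map _
  -- D carries range p into N₂ because LDp = p; (1 - U)L undoes Dp on the graph.
  · have hinv : ∀ x ∈ N₁, ((1 - U).comp L) ((D.comp p) x) = x := fun x hx => by
      change L (D (p x)) - U (L (D (p x))) = x
      rw [hLD, hUp, ← hN₁eq x hx]
    refine ⟨N₁.map ((D.comp p : E →L[A] E) : E →ₗ[A] E), ?_,
      isClosed_map_of_leftInvOn hN₁ hinv,
      ⟨(exists_equiv_map_of_leftInvOn (T := D.comp p) hinv).choose⟩⟩
    rintro _ ⟨x, -, rfl⟩
    rw [memN₂]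
    change L (D (p x)) - p (L (D (p x))) = 0
    rw [hLD, hp, sub_self]

variable [CompleteSpace E]

/-- An adjointable operator which is bounded below has an `A`-linear bounded left inverse. -/
theorem exists_leftInverse_of_isBoundedBelowOp {D : E →L[ℂ] E} (hD : D ∈ adjointableOperators A)
    (hb : IsBoundedBelowOp D) : ∃ L : E →L[A] E, ∀ x, L (D x) = x := by
  obtain ⟨D', hD'⟩ := hD
  obtain ⟨c, hc, hb⟩ := hb
  have hpos : ∀ x, 0 ≤ inner A x ((D' * D) x) := fun x => by
    change 0 ≤ inner A x (D' (D x))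
    rw [← hD']
    exact CStarModule.inner_self_nonneg
  have hlower : ∀ x, c ^ 2 * ‖x‖ ≤ ‖(D' * D) x‖ := fun x => by
    rcases eq_or_ne x 0 with rfl | hx0
    · simp
    refine le_of_mul_le_mul_right ?_ (norm_pos_iff.2 hx0)
    -- Cauchy–Schwarz transfers the lower bound from D to D'D; the left inverse will be (D'D)⁻¹D'.
    calc c ^ 2 * ‖x‖ * ‖x‖ = (c * ‖x‖) ^ 2 := by ring
      _ ≤ ‖D x‖ ^ 2 := by gcongr; exact hb x
      _ = ‖inner A x ((D' * D) x)‖ := by rw [CStarModule.norm_sq_eq A, hD']; rfl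
      _ ≤ ‖x‖ * ‖(D' * D) x‖ := CStarModule.norm_inner_le E
      _ = ‖(D' * D) x‖ * ‖x‖ := mul_comm _ _
  have hunit : IsUnit (D' * D) := isUnit_of_forall_nonneg_le_norm_add_smul (pow_pos hc 2)
    fun t ht x => (hlower x).trans (norm_le_norm_add_smul_of_nonneg (hpos x) ht)
  obtain ⟨u, hu⟩ := hunit
  have hinj := (ContinuousLinearMap.isUnit_iff_bijective.1 ⟨u, hu⟩).1
  set R : E →L[ℂ] E := ↑u⁻¹ with hR
  have h1 : ∀ x, (D' * D) (R x) = x := fun x => by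
    rw [← hu]
    exact congrArg (fun T : E →L[ℂ] E => T x) u.mul_inv
  have h2 : ∀ x, R ((D' * D) x) = x := fun x => hinj (h1 _)
  have hDsmul := map_smul_of_adjoint hD'
  have hD'smul := map_smul_of_adjoint (inner_adjoint_symm hD')
  have hRsmul : ∀ (a : A) x, R (a • x) = a • R x := fun a x => hinj <| by
    rw [h1]
    change _ = D' (D (a • R x))
    rw [hDsmul, hD'smul]
    exact congrArg (a • ·) (h1 x).symm
  exact ⟨{ toFun := fun x => R (D' x)
           map_add' := fun x y => by simp
           map_smul' := fun a x => by rw [hD'smul, hRsmul, RingHom.id_apply]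
           cont := R.continuous.comp D'.continuous }, h2⟩

end Decomposition

/-! ### The standard module: completeness, coordinate projections, compact perturbations -/

open Filter Topology

namespace StdModule

variable {A : Type*} [CStarAlgebra A] [PartialOrder A] [StarOrderedRing A]

@[simp] theorem coord_sub (x y : StdModule A) (k : ℕ) :
    (x - y).coord k = x.coord k - y.coord k := rfl

theorem norm_sq_eq_norm_tsum (x : StdModule A) :
    ‖x‖ ^ 2 = ‖∑' k, x.coord k * star (x.coord k)‖ := CStarModule.norm_sq_eq A

/-- The finitely supported sequence that agrees with `v` on `s`. -/
def truncate (s : Finset ℕ) (v : ℕ → A) : StdModule A :=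
  ⟨fun k => if k ∈ s then v k else 0, by
    refine summable_of_ne_finset_zero (s := s) fun k hk => ?_
    simp [hk]⟩

@[simp] theorem coord_truncate (s : Finset ℕ) (v : ℕ → A) (k : ℕ) :
    (truncate s v).coord k = if k ∈ s then v k else 0 := rfl

theorem truncate_add (s : Finset ℕ) (v w : ℕ → A) :
    truncate s (v + w) = truncate s v + truncate s w := by
  ext k
  simp only [coord_truncate, coord_add, Pi.add_apply]
  split_ifs <;> simp

theorem norm_truncate_sq (s : Finset ℕ) (v : ℕ → A) :
    ‖truncate s v‖ ^ 2 = ‖∑ k ∈ s, v k * star (v k)‖ := by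
  rw [norm_sq_eq_norm_tsum, tsum_eq_sum (s := s) fun k hk => by simp [hk]]
  congr 1
  exact Finset.sum_congr rfl fun k hk => by simp [hk]

theorem norm_truncate_coord_le (s : Finset ℕ) (x : StdModule A) :
    ‖truncate s x.coord‖ ≤ ‖x‖ := by
  rw [← pow_le_pow_iff_left₀ (norm_nonneg _) (norm_nonneg _) two_ne_zero, norm_truncate_sq,
    norm_sq_eq_norm_tsum]
  exact CStarAlgebra.norm_le_norm_of_nonneg_of_le
    (Finset.sum_nonneg fun k _ => mul_star_self_nonneg _)
    (x.summable_self.sum_le_tsum s fun k _ => mul_star_self_nonneg _)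

theorem norm_coord_le (x : StdModule A) (k : ℕ) : ‖x.coord k‖ ≤ ‖x‖ := by
  refine le_trans ?_ (norm_truncate_coord_le {k} x)
  rw [← pow_le_pow_iff_left₀ (norm_nonneg _) (norm_nonneg _) two_ne_zero, norm_truncate_sq,
    Finset.sum_singleton, CStarRing.norm_self_mul_star, sq]

theorem norm_le_of_forall_norm_truncate_le {x : StdModule A} {C : ℝ} (hC : 0 ≤ C)
    (h : ∀ s, ‖truncate s x.coord‖ ≤ C) : ‖x‖ ≤ C := by
  rw [← pow_le_pow_iff_left₀ (norm_nonneg _) hC two_ne_zero, norm_sq_eq_norm_tsum]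
  refine le_of_tendsto x.summable_self.hasSum.norm (Eventually.of_forall fun s => ?_)
  rw [← norm_truncate_sq]
  gcongr
  exact h s

instance : CompleteSpace (StdModule A) := by
  refine Metric.complete_of_cauchySeq_tendsto fun u hu => ?_
  have hcoord : ∀ k, CauchySeq fun m => (u m).coord k := fun k => by
    rw [Metric.cauchySeq_iff] at hu ⊢
    intro ε hε
    obtain ⟨N, hN⟩ := hu ε hε
    refine ⟨N, fun m hm l hl => lt_of_le_of_lt ?_ (hN m hm l hl)⟩
    rw [dist_eq_norm, dist_eq_norm, ← coord_sub]
    exact norm_coord_le _ k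
  choose x hx using fun k => cauchySeq_tendsto_of_complete (hcoord k)
  -- The limit x is only a bare sequence so far, so the estimate is made on finite truncations,
  -- uniformly in s.
  have happrox : ∀ ε > 0, ∃ N, ∀ m ≥ N, ∀ s, ‖truncate s ((u m).coord - x)‖ ≤ ε := by
    intro ε hε
    obtain ⟨N, hN⟩ := Metric.cauchySeq_iff.1 hu ε hε
    refine ⟨N, fun m hm s => ?_⟩
    rw [← pow_le_pow_iff_left₀ (norm_nonneg _) hε.le two_ne_zero, norm_truncate_sq]
    have hlim : Tendsto (fun l => ‖∑ k ∈ s, (u m - u l).coord k * star ((u m - u l).coord k)‖)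
        atTop (𝓝 ‖∑ k ∈ s, ((u m).coord - x) k * star (((u m).coord - x) k)‖) := by
      refine (tendsto_finsetSum _ fun k _ => ?_).norm
      have h1 : Tendsto (fun l => (u m - u l).coord k) atTop (𝓝 (((u m).coord - x) k)) :=
        (hx k).const_sub _
      exact h1.mul h1.star
    refine le_of_tendsto hlim ?_
    filter_upwards [eventually_ge_atTop N] with l hl
    rw [← norm_truncate_sq]
    gcongr
    refine (norm_truncate_coord_le _ _).trans ?_
    rw [← dist_eq_norm]
    exact (hN m hm l hl).le
  have hsum : Summable fun k => x k * star (x k) := by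
    rw [summable_iff_vanishing_norm]
    intro ε hε
    -- Vanishing sums are squares of norms; two pieces below √ε/3 stay under √ε.
    have hδ : 0 < √ε / 3 := by positivity
    obtain ⟨N, hN⟩ := happrox _ hδ
    obtain ⟨s, hs⟩ := summable_iff_vanishing_norm.1 (u N).summable_self ((√ε / 3) ^ 2) (by positivity)
    refine ⟨s, fun t ht => ?_⟩
    have h1 := hN N le_rfl t
    have h2 : ‖truncate t (u N).coord‖ < √ε / 3 := by
      rw [← pow_lt_pow_iff_left₀ (norm_nonneg _) hδ.le two_ne_zero, norm_truncate_sq]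
      exact hs t ht
    have h3 : ‖truncate t x‖ < √ε := by
      have : truncate t (u N).coord = truncate t ((u N).coord - x) + truncate t x := by
        rw [← truncate_add, sub_add_cancel]
      have h4 : truncate t x = truncate t (u N).coord - truncate t ((u N).coord - x) := by
        rw [this, add_sub_cancel_left]
      rw [h4]
      refine (norm_sub_le _ _).trans_lt ?_
      linarith
    rw [← norm_truncate_sq]
    calc ‖truncate t x‖ ^ 2 < √ε ^ 2 := by gcongr
      _ = ε := Real.sq_sqrt hε.le
  let x' : StdModule A := ⟨x, hsum⟩
  refine ⟨x', Metric.tendsto_atTop.2 ?_⟩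
  intro ε hε
  obtain ⟨N, hN⟩ := happrox (ε / 2) (half_pos hε)
  refine ⟨N, fun m hm => ?_⟩
  rw [dist_eq_norm]
  exact (norm_le_of_forall_norm_truncate_le (half_pos hε).le (hN m hm)).trans_lt (half_lt_self hε)

/-- The standard basis of `H_A`. -/
def basisVector (A : Type*) [CStarAlgebra A] [PartialOrder A] [StarOrderedRing A] (k : ℕ) :
    StdModule A :=
  truncate {k} 1

theorem inner_basisVector (k : ℕ) (x : StdModule A) :
    inner A (basisVector A k) x = x.coord k := by
  rw [inner_def, tsum_eq_single k fun j hj => by simp [basisVector, hj]]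
  simp [basisVector]

variable (A) in
/-- The orthogonal projection of `H_A` onto the first `n` coordinates. -/
noncomputable def initialProj (n : ℕ) : StdModule A →L[ℂ] StdModule A :=
  ∑ k ∈ Finset.range n, elementaryOperator A (basisVector A k) (basisVector A k)

theorem initialProj_apply (n : ℕ) (x : StdModule A) :
    initialProj A n x = ∑ k ∈ Finset.range n, x.coord k • basisVector A k := by
  simp [initialProj, inner_basisVector]

variable (A) in
theorem inner_initialProj (n : ℕ) (x y : StdModule A) :
    inner A (initialProj A n x) y = inner A x (initialProj A n y) :=
  inner_sum_elementaryOperator_self _ _ _ _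

theorem coord_initialProj (n : ℕ) (x : StdModule A) (j : ℕ) :
    (initialProj A n x).coord j = if j < n then x.coord j else 0 := by
  rw [← inner_basisVector, initialProj_apply]
  refine (inner_sum_smul_right _ _ _ _).trans ?_
  simp only [inner_basisVector]
  simp [basisVector]

theorem initialProj_initialProj (n : ℕ) (x : StdModule A) :
    initialProj A n (initialProj A n x) = initialProj A n x := by
  ext j
  simp only [coord_initialProj]
  split_ifs <;> rfl

theorem norm_sub_initialProj_sq (n : ℕ) (x : StdModule A) :
    ‖x - initialProj A n x‖ ^ 2 = ‖∑' k, x.coord (k + n) * star (x.coord (k + n))‖ := by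
  rw [norm_sq_eq_norm_tsum, ← (x - initialProj A n x).summable_self.sum_add_tsum_nat_add n,
    Finset.sum_eq_zero fun k hk => by
      simp [coord_initialProj, Finset.mem_range.1 hk], zero_add]
  simp [coord_initialProj]

theorem norm_one_sub_initialProj_le (n : ℕ) : ‖1 - initialProj A n‖ ≤ 1 := by
  refine ContinuousLinearMap.opNorm_le_bound _ zero_le_one fun x => ?_
  rw [one_mul, ← pow_le_pow_iff_left₀ (norm_nonneg _) (norm_nonneg _) two_ne_zero]
  change ‖x - initialProj A n x‖ ^ 2 ≤ _
  rw [norm_sub_initialProj_sq, norm_sq_eq_norm_tsum]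
  refine CStarAlgebra.norm_le_norm_of_nonneg_of_le
    (tsum_nonneg fun k => mul_star_self_nonneg _) ?_
  rw [← x.summable_self.sum_add_tsum_nat_add n]
  exact le_add_of_nonneg_left (Finset.sum_nonneg fun k _ => mul_star_self_nonneg _)

theorem tendsto_norm_sub_initialProj (x : StdModule A) :
    Tendsto (fun n => ‖x - initialProj A n x‖) atTop (𝓝 0) := by
  have h := (tendsto_sum_nat_add fun k => x.coord k * star (x.coord k)).norm.sqrt
  simp only [norm_zero, Real.sqrt_zero] at h
  refine h.congr fun n => ?_
  rw [← norm_sub_initialProj_sq, Real.sqrt_sq (norm_nonneg _)]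

/-- Compact operators on `H_A` are approximated by their restrictions to finitely many
coordinates. -/
theorem tendsto_norm_mul_one_sub_initialProj {K : StdModule A →L[ℂ] StdModule A}
    (hK : K ∈ compactOperators A (StdModule A)) :
    Tendsto (fun n => ‖K * (1 - initialProj A n)‖) atTop (𝓝 0) := by
  have hspan : ∀ T ∈ Submodule.span ℂ (Set.range fun p : StdModule A × StdModule A =>
      elementaryOperator A p.1 p.2),
      Tendsto (fun n => ‖T * (1 - initialProj A n)‖) atTop (𝓝 0) := by
    intro T hT
    induction hT using Submodule.span_induction with
    | mem T hT =>
      obtain ⟨⟨x, y⟩, rfl⟩ := hT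
      have h := (tendsto_norm_sub_initialProj y).mul_const ‖x‖
      rw [zero_mul] at h
      refine squeeze_zero (fun n => norm_nonneg _) (fun n => ?_) h
      rw [elementaryOperator_mul_one_sub (inner_initialProj A n)]
      exact LinearMap.mkContinuous_norm_le _ (by positivity) _
    | zero => simp
    | add S T _ _ hS hT =>
      have h := hS.add hT
      rw [zero_add] at h
      refine squeeze_zero (fun n => norm_nonneg _) (fun n => ?_) h
      rw [add_mul]
      exact norm_add_le _ _
    | smul c T _ hT =>
      have h := hT.const_mul ‖c‖
      rw [mul_zero] at h
      refine h.congr fun n => ?_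
      rw [smul_mul_assoc, norm_smul]
  rw [Metric.tendsto_atTop]
  intro ε hε
  obtain ⟨T, hT, hKT⟩ := Metric.mem_closure_iff.1 hK (ε / 2) (half_pos hε)
  obtain ⟨N, hN⟩ := Metric.tendsto_atTop.1 (hspan T hT) (ε / 2) (half_pos hε)
  refine ⟨N, fun n hn => ?_⟩
  have h1 := hN n hn
  rw [dist_eq_norm] at hKT
  rw [Real.dist_0_eq_abs, abs_norm] at h1 ⊢
  -- The bound ‖1 - Pₙ‖ ≤ 1, uniform in n, carries the limit over to the norm closure.
  calc ‖K * (1 - initialProj A n)‖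
      = ‖(K - T) * (1 - initialProj A n) + T * (1 - initialProj A n)‖ := by
        rw [← add_mul, sub_add_cancel]
    _ ≤ ‖K - T‖ * 1 + ‖T * (1 - initialProj A n)‖ := by
        refine (norm_add_le _ _).trans ?_
        gcongr
        refine (norm_mul_le _ _).trans ?_
        gcongr
        exact norm_one_sub_initialProj_le n
    _ < ε := by linarith

/-- A bounded below operator stays bounded below under a small perturbation. -/
theorem _root_.IsBoundedBelowOp.exists_forall_norm_lt {E : Type*} [NormedAddCommGroup E]
    [NormedSpace ℂ E] {D : E →L[ℂ] E} (hD : IsBoundedBelowOp D) :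
    ∃ ε > 0, ∀ T : E →L[ℂ] E, ‖T‖ < ε → IsBoundedBelowOp (D + T) := by
  obtain ⟨c, hc, h⟩ := hD
  refine ⟨c, hc, fun T hT => ⟨c - ‖T‖, sub_pos.2 hT, fun x => ?_⟩⟩
  have h1 := norm_sub_norm_le (D x) (-T x)
  rw [norm_neg, sub_neg_eq_add] at h1
  have h2 := T.le_opNorm x
  have h3 := h x
  rw [sub_mul, add_apply]
  linarith

/-- The tail K(1 - Pₙ) is absorbed into D; the remaining KPₙ vanishes on ker Pₙ. -/
theorem mem_mPhiPlusMinusPrime_of_eq_add {F D K : StdModule A →L[ℂ] StdModule A}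
    (hF : F ∈ adjointableOperators A) (hD : D ∈ adjointableOperators A)
    (hDb : IsBoundedBelowOp D) (hK : K ∈ compactOperators A (StdModule A)) (h : F = D + K) :
    F ∈ mPhiPlusMinusPrime A := by
  refine ⟨hF, ?_⟩
  obtain ⟨ε, hε, hpert⟩ := hDb.exists_forall_norm_lt
  obtain ⟨n, hn⟩ := ((tendsto_norm_mul_one_sub_initialProj hK).eventually_lt_const hε).exists
  set p := initialProj A n with hp
  set D₁ := D + K * (1 - p) with hD₁
  have hD₁b : IsBoundedBelowOp D₁ := hpert _ hn
  -- As a difference of adjointable operators, without appeal to compactness.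
  have hKadj : K ∈ adjointableOperators A := by
    rw [show K = F - D by rw [h, add_sub_cancel_left]]
    exact adjointableOperators.sub hF hD
  have hD₁adj : D₁ ∈ adjointableOperators A :=
    adjointableOperators.add_mul_one_sub hD hKadj (inner_initialProj A n)
  obtain ⟨L, hL⟩ := exists_leftInverse_of_isBoundedBelowOp hD₁adj hD₁b
  obtain ⟨F', hF'⟩ := hF
  obtain ⟨D', hD'⟩ := hD₁adj
  let toA : ∀ T : StdModule A →L[ℂ] StdModule A, (∀ (a : A) x, T (a • x) = a • T x) →
      StdModule A →L[A] StdModule A := fun T hT =>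
    { toFun := T, map_add' := map_add T, map_smul' := hT, cont := T.continuous }
  refine exists_decomposition_of_eqOn_ker (F := toA F (map_smul_of_adjoint hF'))
    (D := toA D₁ (map_smul_of_adjoint hD')) (L := L)
    (p := toA p (map_smul_of_adjoint (inner_initialProj A n))) hL (initialProj_initialProj n)
    ?_ fun x hx => ?_
  · have : LinearMap.range (toA p (map_smul_of_adjoint (inner_initialProj A n)) :
        StdModule A →ₗ[A] StdModule A) =
        Submodule.span A (basisVector A '' Finset.range n) := by
      refine le_antisymm ?_ (Submodule.span_le.2 ?_)
      · rintro _ ⟨x, rfl⟩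
        change p x ∈ _
        rw [hp, initialProj_apply]
        exact Submodule.sum_mem _ fun k hk => Submodule.smul_mem _ _ <|
          Submodule.subset_span ⟨k, hk, rfl⟩
      · rintro _ ⟨k, hk, rfl⟩
        refine ⟨basisVector A k, ?_⟩
        change p (basisVector A k) = _
        ext j
        rw [hp, coord_initialProj]
        have : k < n := Finset.mem_range.1 (Finset.mem_coe.1 hk)
        by_cases hj : j = k
        · simp [hj, this]
        · simp [basisVector, hj]
    rw [this]
    exact Submodule.fg_span ((Finset.range n).finite_toSet.image _)
  · have hx' : p x = 0 := hx
    change F x = D x + K (x - p x)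
    rw [hx', sub_zero, h, add_apply]

end StdModule

theorem theorem5p10 {A : Type*} [CStarAlgebra A] [PartialOrder A] [StarOrderedRing A]
    (F : StdModule A →L[ℂ] StdModule A) (hF : F ∈ adjointableOperators A) :
    F ∈ mPhiPlusMinusPrime A ↔
      ∃ D K : StdModule A →L[ℂ] StdModule A,
        D ∈ adjointableOperators A ∧ IsBoundedBelowOp D ∧
          K ∈ compactOperators A (StdModule A) ∧ F = D + K :=
  ⟨exists_isBoundedBelowOp_add_compact_of_mem_mPhiPlusMinusPrime,
    fun ⟨_, _, hD, hDb, hK, h⟩ => StdModule.mem_mPhiPlusMinusPrime_of_eq_add hF hD hDb hK h⟩
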